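/- Let $G$ be a compactly presented, totally disconnected, locally compact group without non-trivial compact normal subgroups. Then there is a locally compact group $G^\dagger$ admitting $G$ as a closed cocompact subgroup such that all uniform lattices in $G^\dagger$ are locally rigid. Here a topological group is compactly presented if it admits a compact generating set $S$ and a presentation with relations of bounded length in $S$. A subgroup $L$ of a locally compact group $H$ is cocompact if $H = LK$ for some compact subset $K \subset H$, and a uniform lattice in $H$ is a discrete cocompact subgroup. A uniform lattice $\Gamma \le H$ is locally rigid if the inclusion $\Gamma \hookrightarrow H$ has a neighbourhood $\mathcal{U}$ in the space of all homomorphisms $\Gamma \to H$, with the topology of pointwise convergence, such that every $r \in \mathcal{U}$ is of the form $r(\gamma) = g\gamma g^{-1}$ for all $\gamma \in \Gamma$, for some $g \in H$ (depending on $r$). Locally compact groups are Hausdorff. -/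

import Mathlib

open Topology Pointwise

universe u v

/-- A topological group `G` is compactly presented if it has a compact generating set `S` and a
presentation `⟨S ∣ R⟩`, as an abstract group, in which the relators have bounded length as reduced
words in the letters from `S` and their inverses. -/
def IsCompactlyPresented (G : Type u) [Group G] [TopologicalSpace G] : Prop :=
  open Classical in
  ∃ (S : Set G) (R : Set (FreeGroup S)) (n : ℕ),
    IsCompact S ∧
    Function.Surjective (FreeGroup.lift (Subtype.val : S → G)) ∧
    (∀ w ∈ R, w.norm ≤ n) ∧
    Subgroup.normalClosure R = (FreeGroup.lift (Subtype.val : S → G)).ker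

section Lattices

variable {G : Type u} [Group G] [TopologicalSpace G]

/-- A subgroup `L` of `G` is cocompact if `G = L K` for some compact subset `K` of `G`. -/
def IsCocompactSubgroup (L : Subgroup G) : Prop :=
  ∃ K : Set G, IsCompact K ∧ (L : Set G) * K = Set.univ

/-- A uniform lattice is a discrete cocompact subgroup. -/
def IsUniformLattice (Γ : Subgroup G) : Prop :=
  DiscreteTopology Γ ∧ IsCocompactSubgroup Γ

/-- The topology of pointwise convergence on the set of all group homomorphisms from a (discrete)
group `Γ` to `G`; with it, `Γ →* G` is the representation space of `Γ` in `G`. -/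
abbrev representationTopology (Γ : Type v) [Group Γ] (G : Type u) [Group G] [TopologicalSpace G] :
    TopologicalSpace (Γ →* G) :=
  TopologicalSpace.induced (fun r : Γ →* G => (r : Γ → G)) Pi.topologicalSpace

/-- `Γ` is locally rigid in `G` if the inclusion homomorphism has an open neighbourhood in the
representation space of `Γ` in `G` all of whose points arise from the inclusion by conjugation by
an element of `G`. -/
def IsLocallyRigid (Γ : Subgroup G) : Prop :=
  ∃ U : Set (Γ →* G), IsOpen[representationTopology Γ G] U ∧ Γ.subtype ∈ U ∧
    ∀ r ∈ U, ∃ g : G, ∀ γ : Γ, r γ = g * (γ : G) * g⁻¹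

end Lattices

/-! Take a compact open subgroup `U` and a Cayley–Abels graph on `G ⧸ U`, which is connected and
locally finite. The overgroup is its automorphism group; `G` acts by translation with compact
normal, hence trivial, kernel.

Rigidity is local-to-global. If `r` is close to the inclusion of a uniform lattice `Γ`, then setting
`φ (γ f) = r γ f` on a finite set of orbit representatives gives an intertwiner that agrees with an
automorphism on each `R`-ball (`isLocallyRigid_of_bijective_of_isLocalAut`). If `φ` is bijective, it
is an automorphism and conjugates the inclusion to `r`.

Such a `φ` behaves like a covering of graphs, hence is surjective. Compact presentation makes the
graph simply connected at a large scale `R`, which forces injectivity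
(`IsLocalAut.injective_of_presentation`): path lifting gives an action of the free group on a
pull-back, relators lift to closed paths, and words representing elements of `U` fix the vertex
coordinate. -/

/-! ### Balls for a relation -/

section Within

variable {X : Type u} (E : X → X → Prop)

/-- `Within E n x y` means that `y` is reached from `x` by an `E`-chain with exactly `n` steps. For
reflexive `E`, this is the closed ball of radius `n` around `x`. -/
def Within : ℕ → X → X → Prop
  | 0, x, y => x = y
  | n + 1, x, y => ∃ z, Within n x z ∧ E z y

variable {E}

theorem Within.trans {m n : ℕ} {x y z : X} (h : Within E m x y) (h' : Within E n y z) :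
    Within E (m + n) x z := by
  induction n generalizing z with
  | zero => cases h'; exact h
  | succ n ih =>
    obtain ⟨w, hw, hz⟩ := h'
    exact ⟨w, ih hw, hz⟩

theorem Within.of_rel {x y : X} (h : E x y) : Within E 1 x y := ⟨x, rfl, h⟩

theorem Within.refl (hE : ∀ x, E x x) (n : ℕ) (x : X) : Within E n x x := by
  induction n with
  | zero => rfl
  | succ n ih => exact ⟨x, ih, hE x⟩

theorem Within.mono (hE : ∀ x, E x x) {m n : ℕ} (hmn : m ≤ n) {x y : X} (h : Within E m x y) :
    Within E n x y := by
  obtain ⟨k, rfl⟩ := Nat.exists_eq_add_of_le hmn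
  exact h.trans (Within.refl hE k y)

theorem Within.symm (hE : ∀ x y, E x y → E y x) {n : ℕ} {x y : X} (h : Within E n x y) :
    Within E n y x := by
  induction n generalizing y with
  | zero => exact Eq.symm h
  | succ n ih =>
    obtain ⟨z, hz, hzy⟩ := h
    rw [Nat.add_comm]
    exact (Within.of_rel (hE _ _ hzy)).trans (ih hz)

theorem Within.map (σ : E ≃r E) {n : ℕ} {x y : X} (h : Within E n x y) :
    Within E n (σ x) (σ y) := by
  induction n generalizing y with
  | zero => exact congrArg σ h
  | succ n ih =>
    obtain ⟨z, hz, hzy⟩ := h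
    exact ⟨σ z, ih hz, σ.map_rel_iff.2 hzy⟩

theorem Within.finite (hE : ∀ x, {y | E x y}.Finite) (n : ℕ) (x : X) :
    {y | Within E n x y}.Finite := by
  induction n with
  | zero => exact (Set.finite_singleton x).subset fun y hy => Eq.symm hy
  | succ n ih =>
    refine (ih.biUnion fun z _ => hE z).subset fun y hy => ?_
    obtain ⟨z, hz, hzy⟩ := hy
    exact Set.mem_biUnion hz hzy

end Within

/-! ### Automorphism groups of connected, locally finite relations -/

section Topology

variable {X : Type u} [TopologicalSpace X] {E : X → X → Prop}

/-- The permutation topology on the automorphism group of a relation: pointwise convergence of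
automorphisms and of their inverses. -/
instance RelIso.permutationTopology : TopologicalSpace (E ≃r E) :=
  TopologicalSpace.induced (fun σ => ((σ : X → X), ((σ⁻¹ : E ≃r E) : X → X))) inferInstance

theorem RelIso.isInducing_coe_inv :
    IsInducing (fun σ : E ≃r E => ((σ : X → X), ((σ⁻¹ : E ≃r E) : X → X))) := ⟨rfl⟩

theorem RelIso.continuous_apply (x : X) : Continuous fun σ : E ≃r E => σ x :=
  (_root_.continuous_apply x).comp (continuous_fst.comp RelIso.isInducing_coe_inv.continuous)

theorem RelIso.continuous_inv_apply (x : X) : Continuous fun σ : E ≃r E => σ⁻¹ x :=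
  (_root_.continuous_apply x).comp (continuous_snd.comp RelIso.isInducing_coe_inv.continuous)

theorem RelIso.continuous_iff {Y : Type*} [TopologicalSpace Y] {f : Y → (E ≃r E)} :
    Continuous f ↔ (∀ x, Continuous fun y => f y x) ∧ ∀ x, Continuous fun y => (f y)⁻¹ x := by
  rw [RelIso.isInducing_coe_inv.continuous_iff]
  refine (continuous_prodMk (f := fun y => ((f y : E ≃r E) : X → X))
    (g := fun y => (((f y)⁻¹ : E ≃r E) : X → X))).trans ?_
  rw [continuous_pi_iff, continuous_pi_iff]

instance RelIso.instT2Space [T2Space X] : T2Space (E ≃r E) :=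
  T2Space.of_injective_continuous (fun _ _ h => DFunLike.coe_injective (Prod.ext_iff.1 h).1)
    RelIso.isInducing_coe_inv.continuous

variable [DiscreteTopology X]

theorem continuous_eval_of_discrete : Continuous fun p : (X → X) × X => p.1 p.2 :=
  continuous_prod_of_discrete_right.2 fun x => _root_.continuous_apply x

instance RelIso.instIsTopologicalGroup : IsTopologicalGroup (E ≃r E) where
  continuous_mul := by
    have hc : Continuous fun p : (E ≃r E) × X => p.1 p.2 :=
      continuous_prod_of_discrete_right.2 RelIso.continuous_apply
    have hi : Continuous fun p : (E ≃r E) × X => p.1⁻¹ p.2 :=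
      continuous_prod_of_discrete_right.2 RelIso.continuous_inv_apply
    refine RelIso.continuous_iff.2 ⟨fun x => ?_, fun x => ?_⟩
    · exact hc.comp (continuous_fst.prodMk ((RelIso.continuous_apply x).comp continuous_snd))
    · simp only [mul_inv_rev]
      exact hi.comp (continuous_snd.prodMk ((RelIso.continuous_inv_apply x).comp continuous_fst))
  continuous_inv := RelIso.continuous_iff.2
    ⟨RelIso.continuous_inv_apply, by simpa only [inv_inv] using RelIso.continuous_apply⟩

theorem RelIso.isOpen_setOf_apply_eq (x y : X) : IsOpen {σ : E ≃r E | σ x = y} :=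
  (isOpen_discrete {y}).preimage (RelIso.continuous_apply x)

/-- Once the image of `x` is fixed, every other point, under the automorphism or its inverse, moves
within a finite ball; Tychonoff applies. -/
theorem RelIso.isCompact_setOf_apply_eq (hfin : ∀ x, {y | E x y}.Finite)
    (hconn : ∀ x y, ∃ n, Within E n x y) (x y : X) : IsCompact {σ : E ≃r E | σ x = y} := by
  choose d hd using hconn
  rw [RelIso.isInducing_coe_inv.isCompact_iff]
  have hK : IsCompact ((Set.univ.pi fun z => {w | Within E (d x z) y w}) ×ˢ
      (Set.univ.pi fun z => {w | Within E (d y z) x w}) : Set ((X → X) × (X → X))) :=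
    (isCompact_univ_pi fun z => (Within.finite hfin _ _).isCompact).prod
      (isCompact_univ_pi fun z => (Within.finite hfin _ _).isCompact)
  have happ (z : X) : Continuous fun p : (X → X) × (X → X) => p.1 z :=
    (_root_.continuous_apply z).comp continuous_fst
  have happ' (z : X) : Continuous fun p : (X → X) × (X → X) => p.2 z :=
    (_root_.continuous_apply z).comp continuous_snd
  -- Pairs of mutually inverse maps preserving `E`: keeping the inverse as a coordinate makes
  -- bijectivity a closed condition.
  let C : Set ((X → X) × (X → X)) := {p | p.1 x = y} ∩ ((⋂ z, {p | p.1 (p.2 z) = z}) ∩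
    ((⋂ z, {p | p.2 (p.1 z) = z}) ∩ ⋂ a, ⋂ b, {p | E (p.1 a) (p.1 b) ↔ E a b}))
  have hC : IsClosed C := by
    refine (isClosed_eq (happ x) continuous_const).inter (IsClosed.inter ?_ (IsClosed.inter ?_ ?_))
    · exact isClosed_iInter fun z => isClosed_eq
        (continuous_eval_of_discrete.comp (continuous_fst.prodMk (happ' z))) continuous_const
    · exact isClosed_iInter fun z => isClosed_eq
        (continuous_eval_of_discrete.comp (continuous_snd.prodMk (happ z))) continuous_const
    · exact isClosed_iInter fun a => isClosed_iInter fun b =>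
        (isClosed_discrete {q : X × X | E q.1 q.2 ↔ E a b}).preimage ((happ a).prodMk (happ b))
  convert hK.inter_right hC using 1
  ext p
  constructor
  · rintro ⟨σ, rfl, rfl⟩
    refine ⟨⟨fun z _ => (hd x z).map σ, fun z _ => ?_⟩, rfl, ?_, ?_, ?_⟩
    · simpa using (hd (σ x) z).map σ⁻¹
    · simp
    · simp
    · simp [σ.map_rel_iff]
  · rintro ⟨-, hx, h1, h2, h3⟩
    simp only [Set.mem_iInter, Set.mem_ofPred_eq] at h1 h2 h3
    exact ⟨⟨⟨p.1, p.2, h2, h1⟩, h3 _ _⟩, hx, rfl⟩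

theorem RelIso.locallyCompactSpace (hfin : ∀ x, {y | E x y}.Finite)
    (hconn : ∀ x y, ∃ n, Within E n x y) (x : X) : LocallyCompactSpace (E ≃r E) :=
  (RelIso.isCompact_setOf_apply_eq hfin hconn x x).locallyCompactSpace_of_mem_nhds_of_group
    ((RelIso.isOpen_setOf_apply_eq x x).mem_nhds (x := 1) rfl)

end Topology

/-! ### Local automorphisms and local rigidity -/

section Rigidity

variable {X : Type u} {E : X → X → Prop}

/-- A self-map of `X` is a local automorphism at scale `R` if it agrees with an automorphism of `E`
on every ball of radius `R`. -/
def IsLocalAut (E : X → X → Prop) (R : ℕ) (φ : X → X) : Prop :=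
  ∀ x, ∃ σ : E ≃r E, ∀ y, Within E R x y → φ y = σ y

theorem IsLocalAut.rel_iff {R : ℕ} (hR : 1 ≤ R) (hrefl : ∀ x, E x x) {φ : X → X}
    (hφ : IsLocalAut E R φ) (hinj : Function.Injective φ) (x y : X) :
    E (φ x) (φ y) ↔ E x y := by
  obtain ⟨σ, hσ⟩ := hφ x
  have hx : φ x = σ x := hσ x (Within.refl hrefl R x)
  have key {z : X} (hz : E x z) : φ z = σ z := hσ z ((Within.of_rel hz).mono hrefl hR)
  constructor
  · intro h
    have hz : E x (σ.symm (φ y)) := by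
      rw [← σ.map_rel_iff, RelIso.apply_symm_apply, ← hx]
      exact h
    have : σ.symm (φ y) = y := hinj (by rw [key hz, RelIso.apply_symm_apply])
    rwa [this] at hz
  · intro h
    rw [hx, key h, σ.map_rel_iff]
    exact h

variable [TopologicalSpace X] [DiscreteTopology X]

theorem finite_setOf_apply_eq_of_discrete (hfin : ∀ x, {y | E x y}.Finite)
    (hconn : ∀ x y, ∃ n, Within E n x y) (Γ : Subgroup (E ≃r E)) [DiscreteTopology Γ] (x y : X) :
    {γ : Γ | (γ : E ≃r E) x = y}.Finite :=
  isCompact_iff_finite.1 <| Γ.isClosed_of_discrete.isClosedEmbedding_subtypeVal.isCompact_preimage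
    (RelIso.isCompact_setOf_apply_eq hfin hconn x y)

theorem exists_finite_cover_of_isCocompactSubgroup
    (htrans : ∀ x y, ∃ σ : E ≃r E, σ x = y) (x₀ : X) {Γ : Subgroup (E ≃r E)}
    (hΓ : IsCocompactSubgroup Γ) :
    ∃ F : Set X, F.Finite ∧ ∀ x, ∃ γ : Γ, ∃ f ∈ F, (γ : E ≃r E) f = x := by
  obtain ⟨K, hK, hΓK⟩ := hΓ
  refine ⟨(fun σ => σ x₀) '' K,
    isCompact_iff_finite.1 (hK.image (RelIso.continuous_apply x₀)), fun x => ?_⟩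
  obtain ⟨σ, rfl⟩ := htrans x₀ x
  obtain ⟨γ, hγ, k, hk, rfl⟩ : σ ∈ (Γ : Set (E ≃r E)) * K := hΓK ▸ Set.mem_univ σ
  exact ⟨⟨γ, hγ⟩, _, ⟨k, hk, rfl⟩, rfl⟩

/-- If local automorphisms at some scale are bijective, then uniform lattices in the automorphism
group are locally rigid: a representation close to the inclusion is intertwined with it by a local
automorphism. -/
theorem isLocallyRigid_of_bijective_of_isLocalAut (hrefl : ∀ x, E x x)
    (hfin : ∀ x, {y | E x y}.Finite) (hconn : ∀ x y, ∃ n, Within E n x y)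
    (htrans : ∀ x y, ∃ σ : E ≃r E, σ x = y) (x₀ : X) {R : ℕ} (hR : 1 ≤ R)
    (hbij : ∀ φ : X → X, IsLocalAut E R φ → Function.Bijective φ)
    {Γ : Subgroup (E ≃r E)} (hΓ : IsUniformLattice Γ) : IsLocallyRigid Γ := by
  obtain ⟨hdisc, hcoc⟩ := hΓ
  obtain ⟨F, hF, hcov⟩ := exists_finite_cover_of_isCocompactSubgroup htrans x₀ hcoc
  let B : Set X := ⋃ f ∈ F, {y | Within E R f y}
  have hB : B.Finite := hF.biUnion fun f _ => Within.finite hfin R f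
  have hFB {f y : X} (hf : f ∈ F) (hy : Within E R f y) : y ∈ B := Set.mem_biUnion hf hy
  -- The finitely many elements with `δ B` meeting `B`. Closeness to the inclusion only needs
  -- testing for these on `B`.
  let D : Set Γ := ⋃ b ∈ B, ⋃ b' ∈ B, {δ : Γ | (δ : E ≃r E) b = b'}
  have hD : D.Finite := hB.biUnion fun b _ => hB.biUnion fun b' _ =>
    finite_setOf_apply_eq_of_discrete hfin hconn Γ b b'
  let _ := representationTopology Γ (E ≃r E)
  have hcont (δ : Γ) : Continuous fun r : Γ →* (E ≃r E) => r δ :=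
    (_root_.continuous_apply (A := fun _ => E ≃r E) δ).comp
      (continuous_induced_dom (f := fun r : Γ →* (E ≃r E) => (r : Γ → (E ≃r E))))
  refine ⟨⋂ δ ∈ D, ⋂ b ∈ B, {r | r δ b = (δ : E ≃r E) b}, ?_, ?_, fun r hr => ?_⟩
  · exact hD.isOpen_biInter fun δ _ => hB.isOpen_biInter fun b _ =>
      (RelIso.isOpen_setOf_apply_eq b _).preimage (hcont δ)
  · simp
  simp only [Set.mem_iInter, Set.mem_ofPred_eq] at hr
  have hwell {γ γ' : Γ} {b b' : X} (hb : b ∈ B) (hb' : b' ∈ B)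
      (h : (γ : E ≃r E) b = (γ' : E ≃r E) b') : r γ b = r γ' b' := by
    have hδ : ((γ'⁻¹ * γ : Γ) : E ≃r E) b = b' := by
      simp [RelIso.mul_apply, h]
    have := hr (γ'⁻¹ * γ) (Set.mem_biUnion hb (Set.mem_biUnion hb' hδ)) b hb
    rw [hδ, map_mul, map_inv, RelIso.mul_apply] at this
    rw [← this, RelIso.apply_inv_self]
  choose g f hf hgf using hcov
  have hFB' {f : X} (hf : f ∈ F) : f ∈ B := hFB hf (Within.refl hrefl R f)
  let φ : X → X := fun x => r (g x) (f x)
  have hφ (γ : Γ) {b : X} (hb : b ∈ B) : φ ((γ : E ≃r E) b) = r γ b :=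
    hwell (hFB' (hf _)) hb (hgf _)
  have hequiv (γ : Γ) (x : X) : φ ((γ : E ≃r E) x) = r γ (φ x) := by
    obtain ⟨γ', b, hb, rfl⟩ : ∃ γ' : Γ, ∃ b ∈ B, (γ' : E ≃r E) b = x :=
      ⟨g x, f x, hFB' (hf x), hgf x⟩
    rw [hφ γ' hb, ← RelIso.mul_apply, ← RelIso.mul_apply, ← map_mul, ← Subgroup.coe_mul,
      hφ _ hb]
  -- The `R`-ball at `x = g x (f x)` is the `g x`-translate of a ball inside `B`, where `φ ∘ g x = r
  -- (g x)`.
  have hloc : IsLocalAut E R φ := by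
    refine fun x => ⟨r (g x) * (g x : E ≃r E)⁻¹, fun y hy => ?_⟩
    have hb : (g x : E ≃r E)⁻¹ y ∈ B := by
      refine hFB (hf x) ?_
      have := hy.map (g x : E ≃r E)⁻¹
      nth_rewrite 2 [← hgf x] at this
      rwa [RelIso.inv_apply_self] at this
    have := hφ (g x) hb
    rwa [RelIso.apply_inv_self] at this
  have hφb := hbij φ hloc
  let Φ : E ≃r E := ⟨Equiv.ofBijective φ hφb, hloc.rel_iff hR hrefl hφb.1 _ _⟩
  refine ⟨Φ, fun γ => eq_mul_inv_of_mul_eq (RelIso.ext fun x => ?_)⟩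
  exact (hequiv γ x).symm

end Rigidity

/-! ### Cayley–Abels graphs -/

section CayleyAbels

variable {G : Type u} [Group G]

/-- The adjacency relation of the Cayley–Abels graph on `G ⧸ U` with respect to `T`: the coset
`gU` is adjacent to `gtU` for all `g` in `G` and `t` in `T`. -/
def CayleyAbelsRel (U : Subgroup G) (T : Set G) (x y : G ⧸ U) : Prop :=
  ∃ g : G, ∃ t ∈ T, (g : G ⧸ U) = x ∧ ((g * t : G) : G ⧸ U) = y

variable {U : Subgroup G} {T : Set G}

theorem CayleyAbelsRel.refl (hT : 1 ∈ T) (x : G ⧸ U) : CayleyAbelsRel U T x x := by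
  induction x using QuotientGroup.induction_on with
  | H g => exact ⟨g, 1, hT, rfl, by rw [mul_one]⟩

theorem CayleyAbelsRel.symm (hT : ∀ t ∈ T, t⁻¹ ∈ T) (x y : G ⧸ U) (h : CayleyAbelsRel U T x y) :
    CayleyAbelsRel U T y x := by
  obtain ⟨g, t, ht, rfl, rfl⟩ := h
  exact ⟨g * t, t⁻¹, hT t ht, rfl, by rw [mul_inv_cancel_right]⟩

/-- Left translations as automorphisms of the Cayley–Abels relation. -/
def CayleyAbelsRel.translation (U : Subgroup G) (T : Set G) :
    G →* (CayleyAbelsRel U T ≃r CayleyAbelsRel U T) where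
  toFun g :=
    { MulAction.toPerm g with
      map_rel_iff' := by
        have key (g : G) {x y : G ⧸ U} (h : CayleyAbelsRel U T x y) :
            CayleyAbelsRel U T (g • x) (g • y) := by
          obtain ⟨a, t, ht, rfl, rfl⟩ := h
          exact ⟨g * a, t, ht, rfl, by rw [mul_assoc]; rfl⟩
        intro x y
        exact ⟨fun h => by simpa using key g⁻¹ h, key g⟩ }
  map_one' := RelIso.ext fun x => one_smul G x
  map_mul' g h := RelIso.ext fun x => mul_smul g h x

theorem CayleyAbelsRel.translation_apply (g : G) (x : G ⧸ U) :
    CayleyAbelsRel.translation U T g x = g • x := rfl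

theorem CayleyAbelsRel.exists_relIso_apply_eq (x y : G ⧸ U) :
    ∃ σ : CayleyAbelsRel U T ≃r CayleyAbelsRel U T, σ x = y := by
  obtain ⟨g, rfl⟩ := MulAction.exists_smul_eq G x y
  exact ⟨CayleyAbelsRel.translation U T g, rfl⟩

theorem CayleyAbelsRel.exists_within (hT : ∀ t ∈ T, t⁻¹ ∈ T) (hgen : Subgroup.closure T = ⊤)
    (x y : G ⧸ U) : ∃ n, Within (CayleyAbelsRel U T) n x y := by
  have key (g : G) : ∃ n, Within (CayleyAbelsRel U T) n ((1 : G) : G ⧸ U) (g : G ⧸ U) := by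
    have hg : g ∈ Subgroup.closure T := hgen ▸ Subgroup.mem_top g
    induction hg using Subgroup.closure_induction_right with
    | one => exact ⟨0, rfl⟩
    | mul_right a _ t ht ih =>
      obtain ⟨n, hn⟩ := ih
      exact ⟨n + 1, _, hn, a, t, ht, rfl, rfl⟩
    | mul_inv_cancel a _ t ht ih =>
      obtain ⟨n, hn⟩ := ih
      exact ⟨n + 1, _, hn, a, t⁻¹, hT t ht, rfl, rfl⟩
  induction x using QuotientGroup.induction_on with
  | H g =>
  induction y using QuotientGroup.induction_on with
  | H h =>
  obtain ⟨m, hm⟩ := key g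
  obtain ⟨n, hn⟩ := key h
  exact ⟨m + n, (hm.symm (CayleyAbelsRel.symm hT)).trans hn⟩

theorem CayleyAbelsRel.finite_setOf [TopologicalSpace G] [IsTopologicalGroup G]
    (hUo : IsOpen (U : Set G)) (hUc : IsCompact (U : Set G)) (hT : IsCompact T) (x : G ⧸ U) :
    {y | CayleyAbelsRel U T x y}.Finite := by
  have : DiscreteTopology (G ⧸ U) := QuotientGroup.discreteTopology hUo
  induction x using QuotientGroup.induction_on with
  | H g =>
  have hc : IsCompact ((fun k => ((g * k : G) : G ⧸ U)) '' ((U : Set G) * T)) :=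
    (hUc.mul hT).image (continuous_quotient_mk'.comp (continuous_const_mul g))
  refine (isCompact_iff_finite.1 hc).subset ?_
  rintro _ ⟨a, t, ht, ha, rfl⟩
  exact ⟨_, ⟨g⁻¹ * a, QuotientGroup.eq.1 ha.symm, t, ht, rfl⟩, by simp [mul_assoc]⟩

end CayleyAbels

/-! ### Local automorphisms as coverings -/

section Covering

theorem inv_mem_union_inv_union_one {G : Type u} [Group G] {S : Set G} :
    ∀ t ∈ S ∪ S⁻¹ ∪ {1}, t⁻¹ ∈ S ∪ S⁻¹ ∪ {1} := by
  rintro t ((ht | ht) | rfl)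
  · simp [ht]
  · exact Or.inl (Or.inl ht)
  · simp

variable {G : Type u} [Group G] {U : Subgroup G} {T : Set G} {R : ℕ} {φ : G ⧸ U → G ⧸ U}

theorem IsLocalAut.eq_of_within {X : Type u} {E : X → X → Prop} (hrefl : ∀ x, E x x) {φ : X → X}
    (hφ : IsLocalAut E R φ) {x y : X} (h : Within E R x y) (hxy : φ x = φ y) : x = y := by
  obtain ⟨σ, hσ⟩ := hφ x
  rw [hσ x (Within.refl hrefl R x), hσ y h] at hxy
  exact σ.injective hxy

theorem IsLocalAut.exists_lift {X : Type u} {E : X → X → Prop} (hR : 1 ≤ R) (hrefl : ∀ x, E x x)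
    {φ : X → X} (hφ : IsLocalAut E R φ) {x z : X} (h : E (φ x) z) : ∃ y, E x y ∧ φ y = z := by
  obtain ⟨σ, hσ⟩ := hφ x
  have hx : E x (σ.symm z) := by
    rw [← σ.map_rel_iff, RelIso.apply_symm_apply, ← hσ x (Within.refl hrefl R x)]
    exact h
  exact ⟨_, hx, by rw [hσ _ ((Within.of_rel hx).mono hrefl hR), RelIso.apply_symm_apply]⟩

theorem IsLocalAut.surjective {X : Type u} {E : X → X → Prop} (hR : 1 ≤ R) (hrefl : ∀ x, E x x)
    (hconn : ∀ x y, ∃ n, Within E n x y) {φ : X → X} (hφ : IsLocalAut E R φ) :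
    Function.Surjective φ := by
  have key (n : ℕ) (x y : X) (h : Within E n (φ x) y) : ∃ z, φ z = y := by
    induction n generalizing y with
    | zero => exact ⟨x, h⟩
    | succ n ih =>
      obtain ⟨w, hw, hwy⟩ := h
      obtain ⟨z, rfl⟩ := ih w hw
      obtain ⟨z', -, hz'⟩ := hφ.exists_lift hR hrefl hwy
      exact ⟨z', hz'⟩
  intro y
  obtain ⟨n, hn⟩ := hconn (φ y) y
  exact key n y y hn

/-- The pull-back along `φ : G ⧸ U → G ⧸ U` of the projection `g ↦ g⁻¹U`. -/
def CosetPullback (φ : G ⧸ U → G ⧸ U) : Type u :=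
  {p : G × G ⧸ U // φ p.2 = ((p.1⁻¹ : G) : G ⧸ U)}

namespace CosetPullback

theorem ext {p q : CosetPullback φ} (h₁ : p.1.1 = q.1.1) (h₂ : p.1.2 = q.1.2) : p = q :=
  Subtype.ext (Prod.ext h₁ h₂)

theorem exists_step (hR : 1 ≤ R) (hone : 1 ∈ T) (hinv : ∀ t ∈ T, t⁻¹ ∈ T)
    (hφ : IsLocalAut (CayleyAbelsRel U T) R φ) (t : T) (p : CosetPullback φ) :
    ∃ q : CosetPullback φ, q.1.1 = t * p.1.1 ∧ CayleyAbelsRel U T p.1.2 q.1.2 := by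
  -- Because of the inverse in the pull-back, left multiplication by `t` moves the coset along an
  -- edge.
  have h : CayleyAbelsRel U T (φ p.1.2) (((t * p.1.1)⁻¹ : G) : G ⧸ U) :=
    ⟨p.1.1⁻¹, (t : G)⁻¹, hinv t t.2, p.2.symm, by rw [mul_inv_rev]⟩
  obtain ⟨y, hy, hφy⟩ := hφ.exists_lift hR (CayleyAbelsRel.refl hone) h
  exact ⟨⟨(t * p.1.1, y), hφy⟩, rfl, hy⟩

theorem eq_of_within (hone : 1 ∈ T) (hφ : IsLocalAut (CayleyAbelsRel U T) R φ)
    {p q : CosetPullback φ} (h : p.1.1 = q.1.1)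
    (hpq : Within (CayleyAbelsRel U T) R p.1.2 q.1.2) : p = q :=
  ext h (hφ.eq_of_within (CayleyAbelsRel.refl hone) hpq (by rw [p.2, q.2, h]))

/-- For a local automorphism `φ` of the Cayley–Abels relation, elements of `T` act on the pull-back
by lifting edges. -/
theorem exists_perm (hR : 2 ≤ R) (hone : 1 ∈ T) (hinv : ∀ t ∈ T, t⁻¹ ∈ T)
    (hφ : IsLocalAut (CayleyAbelsRel U T) R φ) (t : T) :
    ∃ π : Equiv.Perm (CosetPullback φ), ∀ p, (π p).1.1 = t * p.1.1 ∧
      CayleyAbelsRel U T p.1.2 (π p).1.2 := by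
  have hR1 : 1 ≤ R := by omega
  choose f hf hfE using exists_step hR1 hone hinv hφ
  -- Two lifted edges stay in a ball of radius 2, where `φ` is injective; hence `2 ≤ R`.
  have hff (s t : T) (hst : (s * t : G) = 1) (p : CosetPullback φ) : f s (f t p) = p := by
    refine (eq_of_within hone hφ ?_ ?_).symm
    · rw [hf, hf, ← mul_assoc, hst, one_mul]
    · exact ((Within.of_rel (hfE t p)).trans (Within.of_rel (hfE s _))).mono
        (CayleyAbelsRel.refl hone) hR
  exact ⟨⟨f t, f ⟨(t : G)⁻¹, hinv t t.2⟩, hff _ _ (by simp), hff _ _ (by simp)⟩,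
    fun p => ⟨hf t p, hfE t p⟩⟩

/-- The action of the free group on the pull-back by path lifting. -/
theorem exists_action {S : Set G} (hST : S ⊆ T) (hR : 2 ≤ R) (hone : 1 ∈ T)
    (hinv : ∀ t ∈ T, t⁻¹ ∈ T) (hφ : IsLocalAut (CayleyAbelsRel U T) R φ) :
    ∃ ρ : FreeGroup S →* Equiv.Perm (CosetPullback φ), ∀ (L : List (S × Bool)) (p),
      (ρ (FreeGroup.mk L) p).1.1 =
        FreeGroup.lift (Subtype.val : S → G) (FreeGroup.mk L) * p.1.1 ∧
      Within (CayleyAbelsRel U T) L.length p.1.2 (ρ (FreeGroup.mk L) p).1.2 := by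
  choose π hπ hπE using exists_perm hR hone hinv hφ
  let ρ : FreeGroup S →* Equiv.Perm (CosetPullback φ) :=
    FreeGroup.lift fun s => π ⟨s, hST s.2⟩
  have hcons (a : S) (b : Bool) (L : List (S × Bool)) :
      FreeGroup.mk ((a, b) :: L) = FreeGroup.mk [(a, b)] * FreeGroup.mk L := by
    rw [FreeGroup.mul_mk, List.singleton_append]
  have hletter (a : S) (b : Bool) (p : CosetPullback φ) :
      (ρ (FreeGroup.mk [(a, b)]) p).1.1 =
        FreeGroup.lift (Subtype.val : S → G) (FreeGroup.mk [(a, b)]) * p.1.1 ∧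
      CayleyAbelsRel U T p.1.2 (ρ (FreeGroup.mk [(a, b)]) p).1.2 := by
    cases b with
    | true => simpa [ρ] using ⟨hπ ⟨a, hST a.2⟩ p, hπE ⟨a, hST a.2⟩ p⟩
    | false =>
      obtain ⟨q, rfl⟩ := (π ⟨a, hST a.2⟩).surjective p
      simpa [ρ, hπ] using CayleyAbelsRel.symm hinv _ _ (hπE ⟨a, hST a.2⟩ q)
  refine ⟨ρ, fun L p => ?_⟩
  induction L with
  | nil => simp [← FreeGroup.one_eq_mk, Within]
  | cons c L ih =>
    obtain ⟨a, b⟩ := c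
    obtain ⟨h₁, h₂⟩ := hletter a b (ρ (FreeGroup.mk L) p)
    rw [hcons, map_mul, map_mul, Equiv.Perm.mul_apply]
    exact ⟨by rw [h₁, ih.1, mul_assoc], _, ih.2, h₂⟩

end CosetPullback

/-- A local automorphism of the Cayley–Abels relation is injective, provided its scale exceeds the
length of the relators in a presentation and the word length of the elements of `U`. -/
theorem IsLocalAut.injective_of_presentation {S : Set G} (hT : T = S ∪ S⁻¹ ∪ {1}) (hR : 2 ≤ R)
    {rels : Set (FreeGroup S)} (hrels : ∀ w ∈ rels, ∃ L, List.length L ≤ R ∧ FreeGroup.mk L = w)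
    (hker : Subgroup.normalClosure rels = (FreeGroup.lift (Subtype.val : S → G)).ker)
    (hU : ∀ u ∈ U, ∃ L, List.length L ≤ R ∧
      FreeGroup.lift (Subtype.val : S → G) (FreeGroup.mk L) = u)
    (hconn : ∀ x y, ∃ n, Within (CayleyAbelsRel U T) n x y)
    (hφ : IsLocalAut (CayleyAbelsRel U T) R φ) : Function.Injective φ := by
  have hone : 1 ∈ T := by simp [hT]
  have hinv : ∀ t ∈ T, t⁻¹ ∈ T := hT ▸ inv_mem_union_inv_union_one
  have hrefl := CayleyAbelsRel.refl (U := U) hone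
  have hST : S ⊆ T := fun s hs => by simp [hT, hs]
  obtain ⟨ρ, hρ⟩ := CosetPullback.exists_action hST hR hone hinv hφ
  let ev : FreeGroup S →* G := FreeGroup.lift (Subtype.val : S → G)
  have hρ₁ (w : FreeGroup S) (p : CosetPullback φ) : (ρ w p).1.1 = ev w * p.1.1 := by
    induction w using Quot.inductionOn with
    | _ L => exact (hρ L p).1
  -- A relator lifts to a path of length at most `R` whose ends have the same image under `φ`, so
  -- the path closes up.
  have hkerρ : ev.ker ≤ ρ.ker := by
    rw [← hker]
    refine Subgroup.normalClosure_le_normal fun w hw => ?_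
    have hev : ev w = 1 :=
      MonoidHom.mem_ker.1 (hker ▸ Subgroup.subset_normalClosure hw)
    obtain ⟨L, hL, rfl⟩ := hrels w hw
    refine MonoidHom.mem_ker.2 (Equiv.ext fun p => ?_)
    refine (CosetPullback.eq_of_within hone hφ ?_ ((hρ L p).2.mono hrefl hL)).symm
    rw [hρ₁, hev, one_mul]
  -- Modulo `ρ.ker`, `w` may be replaced by a word of length at most `R`; its lifted path has ends
  -- with equal `φ`-image.
  have hρU (w : FreeGroup S) (hw : ev w ∈ U) (p : CosetPullback φ) : (ρ w p).1.2 = p.1.2 := by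
    obtain ⟨L, hL, hLw⟩ := hU _ hw
    have hwL : ρ w = ρ (FreeGroup.mk L) := by
      rw [← inv_mul_eq_one, ← map_inv, ← map_mul]
      exact hkerρ (by rw [MonoidHom.mem_ker, map_mul, map_inv, inv_mul_eq_one]; exact hLw.symm)
    have hφeq : φ p.1.2 = φ (ρ w p).1.2 := by
      rw [p.2, (ρ w p).2, hρ₁, QuotientGroup.eq]
      simpa using hw
    refine (hφ.eq_of_within hrefl ?_ hφeq).symm
    rw [hwL]
    exact (hρ L p).2.mono hrefl hL
  have hletter (t : G) (ht : t ∈ T) :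
      ∃ L : List (S × Bool), L.length ≤ 1 ∧ ev (FreeGroup.mk L) = t := by
    subst hT
    obtain ((ht | ht) | rfl) := ht
    · exact ⟨[(⟨t, ht⟩, true)], le_rfl, by simp [ev]⟩
    · exact ⟨[(⟨t⁻¹, ht⟩, false)], le_rfl, by simp [ev]⟩
    · exact ⟨[], zero_le_one, map_one ev⟩
  have hreach (n : ℕ) (p : CosetPullback φ) (z : G ⧸ U)
      (h : Within (CayleyAbelsRel U T) n p.1.2 z) : ∃ w, (ρ w p).1.2 = z := by
    induction n generalizing z with
    | zero => exact ⟨1, by simpa [Within] using h⟩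
    | succ n ih =>
      obtain ⟨y, hy, hyz⟩ := h
      obtain ⟨w, rfl⟩ := ih y hy
      set q := ρ w p with hq
      obtain ⟨σ, hσ⟩ := hφ q.1.2
      have hyz' : CayleyAbelsRel U T (φ q.1.2) (φ z) := by
        rw [hσ _ (Within.refl hrefl R _), hσ z ((Within.of_rel hyz).mono hrefl (by omega))]
        exact σ.map_rel_iff.2 hyz
      -- The representative `a` may differ from `q.1.1⁻¹` by an element of `U`. Acting by that
      -- element first corrects it without moving the vertex; then `t⁻¹` lifts the edge to `z`.
      obtain ⟨a, t, ht, ha, hat⟩ := hyz'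
      rw [q.2, QuotientGroup.eq] at ha
      obtain ⟨Lu, -, hu⟩ := hU _ ha
      obtain ⟨Lt, hLt, hLt'⟩ := hletter t⁻¹ (hinv t ht)
      set q' := ρ (FreeGroup.mk Lu) q with hq'
      have hq'₁ : q'.1.1 = a⁻¹ := by
        rw [hq', hρ₁, show ev (FreeGroup.mk Lu) = _ from hu, inv_mul_cancel_right]
      have hq'₂ : q'.1.2 = q.1.2 := hρU _ (show ev (FreeGroup.mk Lu) ∈ U from hu ▸ ha) q
      refine ⟨FreeGroup.mk Lt * FreeGroup.mk Lu * w, ?_⟩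
      rw [map_mul, map_mul, Equiv.Perm.mul_apply, Equiv.Perm.mul_apply, ← hq, ← hq']
      have hnear := ((hρ Lt q').2.mono hrefl hLt).symm (CayleyAbelsRel.symm hinv)
      rw [hq'₂] at hnear
      refine hφ.eq_of_within hrefl ((hnear.trans (Within.of_rel hyz)).mono hrefl hR) ?_
      rw [(ρ (FreeGroup.mk Lt) q').2, hρ₁, hLt', hq'₁, ← hat, mul_inv_rev, inv_inv, inv_inv]
  intro y₁ y₂ hy
  obtain ⟨g, hg⟩ := QuotientGroup.mk_surjective (φ y₁)
  let p : CosetPullback φ := ⟨(g⁻¹, y₁), by rw [inv_inv]; exact hg.symm⟩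
  obtain ⟨n, hn⟩ := hconn y₁ y₂
  obtain ⟨w, hw⟩ := hreach n p y₂ hn
  have hwU : ev w ∈ U := by
    have h := (ρ w p).2
    rw [hw, ← hy, ← hg, hρ₁, QuotientGroup.eq] at h
    simpa [p] using h
  rw [← hw, hρU w hwU p]

end Covering

/-! ### Compact open subgroups and word length -/

section TotallyDisconnected

variable {G : Type u} [Group G] [TopologicalSpace G] [IsTopologicalGroup G]

/-- Van Dantzig's theorem. -/
theorem exists_isOpen_isCompact_subgroup [LocallyCompactSpace G] [T2Space G]
    [TotallyDisconnectedSpace G] :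
    ∃ U : Subgroup G, IsOpen (U : Set G) ∧ IsCompact (U : Set G) := by
  obtain ⟨K, hK, h1K⟩ := exists_compact_mem_nhds (1 : G)
  obtain ⟨W, hW, h1W, hWK⟩ := (loc_compact_Haus_tot_disc_of_zero_dim (H := G)).mem_nhds_iff.1 h1K
  have hWc : IsCompact W := hK.of_isClosed_subset hW.isClosed hWK
  obtain ⟨V, hV, hVW⟩ := compact_open_separated_mul_left hWc hW.isOpen subset_rfl
  let U : Subgroup G := MulAction.stabilizer G W
  have hUo : IsOpen (U : Set G) := by
    refine U.isOpen_of_mem_nhds (g := 1) ?_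
    -- Both `v` and `v⁻¹` map `W` into itself, so `v` stabilizes `W`.
    filter_upwards [hV, inv_mem_nhds_one G hV] with v hv hv'
    have key {v : G} (hv : v ∈ V) : v • W ⊆ W := by
      rintro _ ⟨w, hw, rfl⟩
      exact hVW (Set.mul_mem_mul hv hw)
    exact (key hv).antisymm (Set.subset_smul_set_iff.2 (key hv'))
  refine ⟨U, hUo, hWc.of_isClosed_subset (U.isClosed_of_isOpen hUo) fun g hg => ?_⟩
  have : g • W = W := hg
  rw [← this]
  exact ⟨1, h1W, mul_one g⟩

/-- In a locally compact group generated by a compact set, word length is bounded on compact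
sets. -/
theorem IsCompact.exists_forall_exists_length_le [LocallyCompactSpace G] [T2Space G] {S : Set G}
    (hS : IsCompact S) (hsurj : Function.Surjective (FreeGroup.lift (Subtype.val : S → G)))
    {C : Set G} (hC : IsCompact C) :
    ∃ n, ∀ g ∈ C, ∃ L, List.length L ≤ n ∧
      FreeGroup.lift (Subtype.val : S → G) (FreeGroup.mk L) = g := by
  let A : ℕ → Set G := fun n => {g | ∃ L, List.length L ≤ n ∧
      FreeGroup.lift (Subtype.val : S → G) (FreeGroup.mk L) = g}
  have hsucc (n : ℕ) : A (n + 1) = (S ∪ S⁻¹ ∪ {1}) * A n := by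
    ext g
    constructor
    · rintro ⟨_ | ⟨⟨a, b⟩, L⟩, hL, rfl⟩
      · exact ⟨1, Or.inr rfl, 1, ⟨[], by simp, map_one _⟩, mul_one 1⟩
      · refine ⟨FreeGroup.lift (Subtype.val : S → G) (FreeGroup.mk [(a, b)]), ?_, _,
          ⟨L, by simpa using hL, rfl⟩, ?_⟩
        · cases b <;> simp
        · simp only [← map_mul, FreeGroup.mul_mk, List.singleton_append]
    · rintro ⟨t, (ht | ht) | rfl, _, ⟨L, hL, rfl⟩, rfl⟩
      · exact ⟨(⟨t, ht⟩, true) :: L, by simpa using hL, by simp⟩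
      · exact ⟨(⟨t⁻¹, ht⟩, false) :: L, by simpa using hL, by simp⟩
      · exact ⟨L, by omega, (one_mul _).symm⟩
  have hAc (n : ℕ) : IsCompact (A n) := by
    induction n with
    | zero =>
      convert isCompact_singleton (x := (1 : G))
      ext g
      constructor
      · rintro ⟨L, hL, rfl⟩
        rw [List.length_eq_zero_iff.1 (Nat.le_zero.1 hL)]
        exact map_one _
      · rintro rfl
        exact ⟨[], le_rfl, map_one _⟩
    | succ n ih =>
      rw [hsucc]
      exact ((hS.union hS.inv).union isCompact_singleton).mul ih
  have hmono : Monotone A := fun m n hmn g ⟨L, hL, hg⟩ => ⟨L, hL.trans hmn, hg⟩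
  have hmem (g : G) : ∃ n, g ∈ A n := by
    obtain ⟨w, rfl⟩ := hsurj g
    induction w using Quot.inductionOn with
    | _ L => exact ⟨L.length, L, le_rfl, rfl⟩
  have hmul {m n : ℕ} {g h : G} (hg : g ∈ A m) (hh : h ∈ A n) : g * h ∈ A (m + n) := by
    obtain ⟨L, hL, rfl⟩ := hg
    obtain ⟨L', hL', rfl⟩ := hh
    exact ⟨L ++ L', by simp; omega, by rw [← FreeGroup.mul_mk, map_mul]⟩
  -- Baire: some word ball has interior, and its translates lie in larger word balls.
  obtain ⟨n, x, hx⟩ := nonempty_interior_of_iUnion_of_closed (fun n => (hAc n).isClosed)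
    (Set.iUnion_eq_univ_iff.2 hmem)
  have hcov : C ⊆ ⋃ n, interior (A n) := by
    intro g _
    obtain ⟨m, hm⟩ := hmem (g * x⁻¹)
    refine Set.mem_iUnion.2 ⟨m + n, interior_maximal ?_ (isOpen_interior.smul (g * x⁻¹))
      ⟨x, hx, inv_mul_cancel_right g x⟩⟩
    rintro _ ⟨y, hy, rfl⟩
    exact hmul hm (interior_subset hy)
  obtain ⟨k, hk⟩ := hC.elim_directed_cover (fun n => interior (A n)) (fun _ => isOpen_interior)
    hcov (Monotone.directed_le fun m n h => interior_mono (hmono h))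
  exact ⟨k, fun g hg => interior_subset (s := A k) (hk hg)⟩

end TotallyDisconnected

/-! ### The embedding by translations -/

section Translation

variable {G : Type u} [Group G] [TopologicalSpace G] [IsTopologicalGroup G] {U : Subgroup G}
  {T : Set G}

theorem CayleyAbelsRel.continuous_translation (hU : IsOpen (U : Set G)) :
    Continuous (CayleyAbelsRel.translation U T) := by
  have : DiscreteTopology (G ⧸ U) := QuotientGroup.discreteTopology hU
  refine RelIso.continuous_iff.2 ⟨fun x => ?_, fun x => ?_⟩
  · exact continuous_id.smul continuous_const
  · simp only [← map_inv]
    exact continuous_inv.smul continuous_const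

theorem CayleyAbelsRel.injective_translation
    (hU : IsCompact (U : Set G)) (hUc : IsClosed (U : Set G))
    (hnormal : ∀ N : Subgroup G, N.Normal → IsCompact (N : Set G) → N = ⊥) :
    Function.Injective (CayleyAbelsRel.translation U T) := by
  rw [← MonoidHom.ker_eq_bot_iff]
  have hker : (CayleyAbelsRel.translation U T).ker = U.normalCore := by
    rw [Subgroup.normalCore_eq_ker]
    ext g
    rw [MonoidHom.mem_ker, MonoidHom.mem_ker, RelIso.ext_iff, Equiv.ext_iff]
    rfl
  rw [hker]
  exact hnormal _ inferInstance
    (hU.of_isClosed_subset (U.normalCore_isClosed hUc) U.normalCore_le)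

/-- Translation is proper: a compact set of automorphisms sends the base vertex to finitely many
cosets, so its preimage lies in a finite union of compact cosets of `U`. -/
theorem CayleyAbelsRel.isClosedEmbedding_translation (hUo : IsOpen (U : Set G))
    (hU : IsCompact (U : Set G))
    [LocallyCompactSpace (CayleyAbelsRel U T ≃r CayleyAbelsRel U T)] [T2Space G]
    (hnormal : ∀ N : Subgroup G, N.Normal → IsCompact (N : Set G) → N = ⊥) :
    IsClosedEmbedding (CayleyAbelsRel.translation U T) := by
  have : DiscreteTopology (G ⧸ U) := QuotientGroup.discreteTopology hUo
  have hcont := CayleyAbelsRel.continuous_translation (T := T) hUo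
  refine .of_continuous_injective_isClosedMap hcont
    (CayleyAbelsRel.injective_translation hU hU.isClosed hnormal) ?_
  refine (isProperMap_iff_isCompact_preimage.2 ⟨hcont, fun K hK => ?_⟩).isClosedMap
  let x₀ : G ⧸ U := ((1 : G) : G ⧸ U)
  have hF : ((fun σ : CayleyAbelsRel U T ≃r CayleyAbelsRel U T => σ x₀) '' K).Finite :=
    isCompact_iff_finite.1 (hK.image (RelIso.continuous_apply x₀))
  refine (hF.isCompact_biUnion (f := fun y => {g : G | (g : G ⧸ U) = y})
    fun y _ => ?_).of_isClosed_subset (hK.isClosed.preimage hcont) fun g hg => ?_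
  · obtain ⟨h, rfl⟩ := QuotientGroup.mk_surjective y
    convert hU.smul h using 1
    ext g
    rw [Set.mem_smul_set_iff_inv_smul_mem]
    exact eq_comm.trans QuotientGroup.eq
  · refine Set.mem_biUnion ⟨_, hg, rfl⟩ ?_
    change (g : G ⧸ U) = ((g * 1 : G) : G ⧸ U)
    rw [mul_one]

/-- Translations are transitive on vertices, so the compact stabilizer of a vertex is a complement.
-/
theorem CayleyAbelsRel.isCocompactSubgroup_range_translation (hUo : IsOpen (U : Set G))
    (hfin : ∀ x, {y | CayleyAbelsRel U T x y}.Finite)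
    (hconn : ∀ x y, ∃ n, Within (CayleyAbelsRel U T) n x y) :
    IsCocompactSubgroup (CayleyAbelsRel.translation U T).range := by
  have : DiscreteTopology (G ⧸ U) := QuotientGroup.discreteTopology hUo
  let x₀ : G ⧸ U := ((1 : G) : G ⧸ U)
  refine ⟨_, RelIso.isCompact_setOf_apply_eq hfin hconn x₀ x₀, Set.eq_univ_of_forall fun σ => ?_⟩
  obtain ⟨g, hg⟩ := MulAction.exists_smul_eq G x₀ (σ x₀)
  refine ⟨CayleyAbelsRel.translation U T g, ⟨g, rfl⟩, (CayleyAbelsRel.translation U T g)⁻¹ * σ,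
    ?_, mul_inv_cancel_left _ _⟩
  change (CayleyAbelsRel.translation U T g)⁻¹ (σ x₀) = x₀
  rw [← hg, ← CayleyAbelsRel.translation_apply (T := T), RelIso.inv_apply_self]

end Translation

/-! ### The main theorem -/

theorem corollary3 (G : Type u) [Group G] [TopologicalSpace G] [IsTopologicalGroup G]
    [LocallyCompactSpace G] [TotallyDisconnectedSpace G]
    (hpres : IsCompactlyPresented G)
    (hnormal : ∀ N : Subgroup G, N.Normal → IsCompact (N : Set G) → N = ⊥) :
    ∃ (H : Type u) (_ : Group H) (_ : TopologicalSpace H) (_ : IsTopologicalGroup H)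
      (_ : LocallyCompactSpace H) (_ : T2Space H) (ι : G →* H),
      IsClosedEmbedding ι ∧ IsCocompactSubgroup ι.range ∧
        ∀ Γ : Subgroup H, IsUniformLattice Γ → IsLocallyRigid Γ := by
  obtain ⟨U, hUo, hUc⟩ := exists_isOpen_isCompact_subgroup (G := G)
  obtain ⟨S, rels, n, hS, hsurj, hnorm, hker⟩ := hpres
  obtain ⟨m, hm⟩ := hS.exists_forall_exists_length_le hsurj hUc
  have : DiscreteTopology (G ⧸ U) := QuotientGroup.discreteTopology hUo
  obtain ⟨T, hT⟩ : ∃ T, T = S ∪ S⁻¹ ∪ {1} := ⟨_, rfl⟩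
  have hone : 1 ∈ T := by simp [hT]
  have hinv : ∀ t ∈ T, t⁻¹ ∈ T := hT ▸ inv_mem_union_inv_union_one
  have hTc : IsCompact T := hT ▸ (hS.union hS.inv).union isCompact_singleton
  have hgen : Subgroup.closure T = ⊤ := by
    refine top_le_iff.1 (le_trans ?_ (Subgroup.closure_mono (hT ▸
      Set.subset_union_left.trans Set.subset_union_left : S ⊆ T)))
    rw [← MonoidHom.range_eq_top.2 hsurj, FreeGroup.range_lift_eq_closure, Subtype.range_val]
  have hrefl := CayleyAbelsRel.refl (U := U) hone
  have hfin := CayleyAbelsRel.finite_setOf hUo hUc hTc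
  have hconn := CayleyAbelsRel.exists_within (U := U) hinv hgen
  have hlc := RelIso.locallyCompactSpace hfin hconn ((1 : G) : G ⧸ U)
  refine ⟨CayleyAbelsRel U T ≃r CayleyAbelsRel U T, inferInstance, inferInstance, inferInstance,
    hlc, inferInstance, CayleyAbelsRel.translation U T,
    CayleyAbelsRel.isClosedEmbedding_translation hUo hUc hnormal,
    CayleyAbelsRel.isCocompactSubgroup_range_translation hUo hfin hconn, fun Γ hΓ => ?_⟩
  -- The scale dominates the word length `m` on `U`, the relator length `n`, and the 2 needed for
  -- path lifting.
  have hR : 1 ≤ m + n + 2 := by omega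
  refine isLocallyRigid_of_bijective_of_isLocalAut hrefl hfin hconn
    CayleyAbelsRel.exists_relIso_apply_eq ((1 : G) : G ⧸ U) hR (fun φ hφ =>
      ⟨hφ.injective_of_presentation hT (by omega) (fun w hw => ?_) hker (fun u hu => ?_) hconn,
        hφ.surjective hR hrefl hconn⟩) hΓ
  · classical
    exact ⟨w.toWord, (hnorm w hw).trans (by omega), FreeGroup.mk_toWord⟩
  · obtain ⟨L, hL, hLu⟩ := hm u hu
    exact ⟨L, by omega, hLu⟩
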